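/- Let $q(x_1,\dots,x_k)=S_1(\dots),\dots,S_\ell(\dots)$ be a full conjunctive query without self-joins, with $\ell\ge 1$ atoms of positive arity, in which every variable occurs in some atom. An instance $I$ over the domain $[n]$ consists of one finite relation over $[n]$ for every symbol $S_j$, and $q(I)$ is the set of all $x\in[n]^k$ whose projection on each atom is a tuple of the corresponding relation. Let $\rho^*(q)$ be the fractional edge cover number of $q$: the minimum of $\sum_j w_j$ over all weights $w_j\ge 0$ such that $\sum_{j:\,x_i\in\mathrm{vars}(S_j)}w_j\ge 1$ for every variable $x_i$. An MPC algorithm runs on $p$ servers, is deterministic, and may depend on $q$, $n$ and $p$. The input tuples are initially partitioned among the servers in some way (for example uniformly). In each of $r$ rounds every server sends to every server a bit string that depends on the input tuples stored at the sender and on the data the sender received in the earlier rounds; the data that a server receives in a round is the concatenation, in the order of the senders, of the bit strings sent to it. After $r$ rounds every server outputs a set of tuples that depends only on the data it has received (so that a server that wants to use its own stored tuples in its output has to send them to itself). The algorithm computes $q$ on $I$ if the union of the outputs is $q(I)$. Its load on $I$ is the maximum number of bits received by any server in any round. Then there are a constant $C$ and, for every $m\ge 1$, a set $\mathcal F_m$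 of instances over a domain $[n_m]$ with $n_m\le C\,m$ in which every relation has exactly $m$ tuples, such that the following holds. For every $r$ there is a constant $c>0$, depending only on $q$ and $r$ (and the family), such that for all $m\ge 1$ and $p\ge 1$, every MPC algorithm with $p$ servers and $r$ rounds that computes $q$ on all instances in $\mathcal F_m$ has load at least $$c\cdot\frac{m}{p^{1/\rho^*(q)}}$$ on some instance in $\mathcal F_m$. In other words, every algorithm that computes $q$ with $p$ servers in a constant number of rounds requires load $\Omega(m/p^{1/\rho^*(q)})$, in bits. -/

import Mathlib

namespace MPC

/-- A full conjunctive query without self-joins,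
`q(x_1, …, x_k) = S_1(…), …, S_ℓ(…)`.  The atom `j` has its own relation symbol `S_j` of arity
`arity j`, and `atom j a` is the variable at position `a` of that atom.  There is at least one
atom, arities are positive, and the variables are exactly those that occur in the atoms. -/
structure ConjunctiveQuery where
  /-- the number `k` of variables -/
  numVars : ℕ
  /-- the number `ℓ` of atoms -/
  numAtoms : ℕ
  /-- the arity of each relation symbol -/
  arity : Fin numAtoms → ℕ
  /-- the variable at each position of each atom -/
  atom : (j : Fin numAtoms) → Fin (arity j) → Fin numVars
  numAtoms_pos : 0 < numAtoms
  arity_pos : ∀ j, 0 < arity j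
  occurs : ∀ i, ∃ j a, atom j a = i

namespace ConjunctiveQuery

/-- The set of variables of the atom `S_j`. -/
def vars (q : ConjunctiveQuery) (j : Fin q.numAtoms) : Finset (Fin q.numVars) :=
  Finset.univ.image (q.atom j)

/-- A fractional edge cover: non-negative weights of the atoms such that, for every variable, the
weights of the atoms that contain it sum to at least `1`. -/
def IsFractionalEdgeCover (q : ConjunctiveQuery) (w : Fin q.numAtoms → ℝ) : Prop :=
  (∀ j, 0 ≤ w j) ∧
    ∀ i, 1 ≤ ∑ j ∈ Finset.univ.filter (fun j => i ∈ q.vars j), w j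

/-- The fractional edge cover number `ρ*(q)`: the least total weight of a fractional edge
cover. -/
noncomputable def edgeCoverNumber (q : ConjunctiveQuery) : ℝ :=
  sInf {s | ∃ w : Fin q.numAtoms → ℝ, q.IsFractionalEdgeCover w ∧ s = ∑ j, w j}

end ConjunctiveQuery

/-- A database instance with values in a domain of size `n`: a finite relation for every relation
symbol. -/
abbrev Instance (q : ConjunctiveQuery) (n : ℕ) : Type :=
  (j : Fin q.numAtoms) → Finset (Fin (q.arity j) → Fin n)

/-- The answer `q(I)`: all valuations of the variables that map every atom to a tuple of its
relation. -/
def answers (q : ConjunctiveQuery) {n : ℕ} (I : Instance q n) :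
    Set (Fin q.numVars → Fin n) :=
  {x | ∀ j, x ∘ q.atom j ∈ I j}

/-- A (deterministic) MPC algorithm for the query `q` over a domain of size `n` on `p` servers.

* `home` is the initial partition of the input: on input `I` the tuple `t` of the relation `S_j`
  is stored at the server `home I j t`.  The partition is arbitrary; the uniform one is a special
  case.
* `send t u v D h` is the bit string that server `u` sends to server `v` in round `t` when `D` is
  the part of the input stored at `u` and `h` is the list of bit strings that `u` received in the
  earlier rounds.
* `output v h` is what server `v` outputs when `h` is the list of bit strings it received.  As
  usual in lower bounds for this model, input tuples have to be distributed in some round before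
  a server can compute with them: a server that wants to use tuples stored at itself can send
  them to itself, at the same cost as any other data. -/
structure Algorithm (q : ConjunctiveQuery) (n p : ℕ) where
  home : Instance q n → (j : Fin q.numAtoms) → (Fin (q.arity j) → Fin n) → Fin p
  send : ℕ → Fin p → Fin p → Instance q n → List (List Bool) → List Bool
  output : Fin p → List (List Bool) → Finset (Fin q.numVars → Fin n)

namespace Algorithm

variable {q : ConjunctiveQuery} {n p : ℕ}

/-- The part of the input that is initially stored at server `u`. -/
def stored (A : Algorithm q n p) (I : Instance q n) (u : Fin p) : Instance q n :=
  fun j => (I j).filter (fun t => A.home I j t = u)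

/-- `A.history I t v` is the list of the bit strings received by server `v` in the first `t`
rounds on input `I`.  The data received in one round is the concatenation of the messages of all
servers; whatever else the receiver has to know about them (sender, length) is part of the data
and is paid for in bits. -/
def history (A : Algorithm q n p) (I : Instance q n) : ℕ → Fin p → List (List Bool)
  | 0, _ => []
  | t + 1, v => history A I t v ++
      [(List.ofFn fun u => A.send t u v (A.stored I u) (history A I t u)).flatten]

/-- The bit string received by server `v` in round `t` (rounds are numbered from `0`). -/
def received (A : Algorithm q n p) (I : Instance q n) (t : ℕ) (v : Fin p) : List Bool :=
  (List.ofFn fun u => A.send t u v (A.stored I u) (A.history I t u)).flatten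

/-- The load of an `r`-round run on input `I`: the maximal number of bits received by any server
in any round. -/
def load (A : Algorithm q n p) (r : ℕ) (I : Instance q n) : ℕ :=
  (Finset.range r).sup fun t => Finset.univ.sup fun v => (A.received I t v).length

/-- On input `I` the algorithm computes `q(I)` in `r` rounds: `q(I)` is the union of the outputs
of the servers. -/
def ComputesOn (A : Algorithm q n p) (r : ℕ) (I : Instance q n) : Prop :=
  (⋃ v, (A.output v (A.history I r v) : Set (Fin q.numVars → Fin n))) = answers q I

end Algorithm

end MPC

namespace MPC

open Finset

namespace ConjunctiveQuery

variable (q : ConjunctiveQuery)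

/-! The argument counts answers over a family of instances encoding independent random bits. By LP
duality, `ρ*` is also the total of an optimal fractional vertex packing `u`. A grid with sides about
`m ^ u i` has about `m ^ ρ*` points, but at most `m` projections on each atom. Each relation gets
`m` slots holding two candidate tuples each, which together include those projections; one bit per
slot selects the tuple present. A grid point is then an answer for at least a `2 ^ (-ℓ)` fraction of
the choices.

A server's output depends only on its history, which takes at most `2 ^ B` values with `B = (L + 1)
* r` for load `L`. If the output for some history uses `K` input tuples, correctness forces `K`
selection bits, so that history occurs for at most a `2 ^ (-K)` fraction of the choices; the AGM
inequality bounds the output by `K ^ ρ*`. Outputs with `K ≤ 2 * B` contribute at most `(2 * B) ^ ρ*`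
on average, and the rest only a constant in total (`sum_card_output_le`). Summing over servers gives
`m ^ ρ* ≤ p * D * L ^ ρ*`, where `D` depends on `q` and `r`. -/

theorem mem_vars {j : Fin q.numAtoms} {i : Fin q.numVars} :
    i ∈ q.vars j ↔ ∃ a, q.atom j a = i := by
  simp [vars]

theorem exists_mem_vars (i : Fin q.numVars) : ∃ j, i ∈ q.vars j := by
  obtain ⟨j, a, h⟩ := q.occurs i
  exact ⟨j, (q.mem_vars).2 ⟨a, h⟩⟩

theorem numVars_pos : 0 < q.numVars :=
  (Fin.pos (q.atom ⟨0, q.numAtoms_pos⟩ ⟨0, q.arity_pos _⟩))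

/-! ### Linear programming duality -/

/-- A fractional vertex packing: non-negative weights of the variables such that the weights in
every atom sum to at most `1`. -/
def IsFractionalVertexPacking (u : Fin q.numVars → ℝ) : Prop :=
  (∀ i, 0 ≤ u i) ∧ ∀ j, ∑ i ∈ q.vars j, u i ≤ 1

variable {q}

theorem sum_packing_le_sum_cover {u : Fin q.numVars → ℝ} {w : Fin q.numAtoms → ℝ}
    (hu : q.IsFractionalVertexPacking u) (hw : q.IsFractionalEdgeCover w) :
    ∑ i, u i ≤ ∑ j, w j := by
  calc ∑ i, u i ≤ ∑ i, u i * ∑ j, (if i ∈ q.vars j then w j else 0) := by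
        refine sum_le_sum fun i _ => ?_
        have := hw.2 i
        rw [sum_filter] at this
        exact le_mul_of_one_le_right (hu.1 i) this
    _ = ∑ j, w j * ∑ i, (if i ∈ q.vars j then u i else 0) := by
        simp_rw [mul_sum]
        rw [sum_comm]
        refine sum_congr rfl fun j _ => sum_congr rfl fun i _ => ?_
        split_ifs <;> ring
    _ ≤ ∑ j, w j := by
        refine sum_le_sum fun j _ => ?_
        have := hu.2 j
        rw [← sum_filter, filter_mem_eq_inter, univ_inter]
        exact mul_le_of_le_one_right (hw.1 j) this

variable (q)

/-- Linear programming duality for fractional edge covers and fractional vertex packings. -/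
theorem exists_cover_packing :
    ∃ (w : Fin q.numAtoms → ℝ) (u : Fin q.numVars → ℝ), q.IsFractionalEdgeCover w ∧
      q.IsFractionalVertexPacking u ∧ ∑ i, u i = ∑ j, w j := by
  have : NeZero q.numVars := ⟨q.numVars_pos.ne'⟩
  have : NeZero q.numAtoms := ⟨q.numAtoms_pos.ne'⟩
  -- Payoff of the zero-sum incidence game: variables minimise, atoms maximise. At a saddle point
  -- the value `v` bounds all atom sums of `a` above and all variable sums of `b` below, so dividing
  -- both strategies by `v` makes them feasible, with common total `1 / v`.
  let f : (Fin q.numVars → ℝ) → (Fin q.numAtoms → ℝ) → ℝ := fun u w =>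
    ∑ i, ∑ j, if i ∈ q.vars j then u i * w j else 0
  have hfu (w) : IsLinearMap ℝ (fun u => f u w) := by
    constructor
    · intro x y
      simp only [f, Pi.add_apply, ← sum_add_distrib]
      refine sum_congr rfl fun i _ => sum_congr rfl fun j _ => ?_
      split_ifs <;> ring
    · intro c x
      simp only [f, Pi.smul_apply, smul_eq_mul, mul_sum]
      refine sum_congr rfl fun i _ => sum_congr rfl fun j _ => ?_
      split_ifs <;> ring
  have hfw (u) : IsLinearMap ℝ (fun w => f u w) := by
    constructor
    · intro x y
      simp only [f, Pi.add_apply, ← sum_add_distrib]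
      refine sum_congr rfl fun i _ => sum_congr rfl fun j _ => ?_
      split_ifs <;> ring
    · intro c x
      simp only [f, Pi.smul_apply, smul_eq_mul, mul_sum]
      refine sum_congr rfl fun i _ => sum_congr rfl fun j _ => ?_
      split_ifs <;> ring
  obtain ⟨a, ha, b, hb, hab⟩ := Sion.exists_isSaddlePointOn
    (X := stdSimplex ℝ (Fin q.numVars)) (Y := stdSimplex ℝ (Fin q.numAtoms)) (f := f)
    ⟨_, single_mem_stdSimplex ℝ 0⟩ (convex_stdSimplex ℝ _) (isCompact_stdSimplex ℝ _)
    (fun w _ => ((hfu w).mk' _).continuous_of_finiteDimensional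
      |>.lowerSemicontinuous.lowerSemicontinuousOn _)
    (fun w _ => (((hfu w).mk' _).convexOn (convex_stdSimplex ℝ _)).quasiconvexOn)
    (convex_stdSimplex ℝ _) ⟨_, single_mem_stdSimplex ℝ 0⟩ (isCompact_stdSimplex ℝ _)
    (fun u _ => ((hfw u).mk' _).continuous_of_finiteDimensional
      |>.upperSemicontinuous.upperSemicontinuousOn _)
    (fun u _ => (((hfw u).mk' _).concaveOn (convex_stdSimplex ℝ _)).quasiconcaveOn)
  set v := f a b
  have hv1 (j) : ∑ i ∈ q.vars j, a i ≤ v := by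
    have := hab a ha _ (single_mem_stdSimplex ℝ j)
    refine le_trans (le_of_eq ?_) this
    simp only [f]
    rw [sum_comm, sum_eq_single j]
    · simp
    · intro j' _ hj
      simp [hj]
    · simp
  have hv2 (i) : v ≤ ∑ j ∈ univ.filter (fun j => i ∈ q.vars j), b j := by
    have := hab _ (single_mem_stdSimplex ℝ i) b hb
    refine le_trans this (le_of_eq ?_)
    simp only [f]
    rw [sum_eq_single i]
    · simp [sum_filter]
    · intro i' _ hj
      simp [hj]
    · simp
  have hv : 0 < v := by
    obtain ⟨i, -, hi⟩ : ∃ i ∈ univ, 0 < a i := by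
      by_contra! h
      have := sum_nonpos h
      rw [ha.2] at this
      linarith
    obtain ⟨j, hj⟩ := q.exists_mem_vars i
    exact hi.trans_le ((single_le_sum (fun i _ => ha.1 i) hj).trans (hv1 j))
  refine ⟨fun j => b j / v, fun i => a i / v, ⟨fun j => div_nonneg (hb.1 j) hv.le, fun i => ?_⟩,
    ⟨fun i => div_nonneg (ha.1 i) hv.le, fun j => ?_⟩, ?_⟩
  · rw [← sum_div, one_le_div hv]
    exact hv2 i
  · rw [← sum_div, div_le_one hv]
    exact hv1 j
  · rw [← sum_div, ← sum_div, ha.2, hb.2]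

theorem exists_optimal_cover_packing :
    ∃ (w : Fin q.numAtoms → ℝ) (u : Fin q.numVars → ℝ), q.IsFractionalEdgeCover w ∧
      q.IsFractionalVertexPacking u ∧ ∑ j, w j = q.edgeCoverNumber ∧
      ∑ i, u i = q.edgeCoverNumber := by
  obtain ⟨w, u, hw, hu, h⟩ := q.exists_cover_packing
  have hmin : IsLeast {s | ∃ w : Fin q.numAtoms → ℝ, q.IsFractionalEdgeCover w ∧ s = ∑ j, w j}
      (∑ j, w j) := by
    refine ⟨⟨w, hw, rfl⟩, ?_⟩
    rintro _ ⟨w', hw', rfl⟩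
    exact h ▸ sum_packing_le_sum_cover hu hw'
  have := hmin.csInf_eq
  exact ⟨w, u, hw, hu, this.symm, h.trans this.symm⟩

theorem IsFractionalEdgeCover.sum_pos {q : ConjunctiveQuery} {w : Fin q.numAtoms → ℝ}
    (hw : q.IsFractionalEdgeCover w) : 0 < ∑ j, w j := by
  have h := hw.2 ⟨0, q.numVars_pos⟩
  have := sum_le_sum_of_subset_of_nonneg
    (filter_subset (fun j => (⟨0, q.numVars_pos⟩ : Fin _) ∈ q.vars j) univ)
    (fun j _ _ => hw.1 j)
  linarith

end ConjunctiveQuery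

/-! ### The AGM inequality -/

/-- Hölder's inequality for exponents whose sum is at least `1`. -/
theorem sum_prod_rpow_le_prod_sum_rpow {ι κ : Type*} (A : Finset ι) (J : Finset κ)
    (g : κ → ι → ℝ) (w : κ → ℝ) (hg : ∀ j ∈ J, ∀ a ∈ A, 0 ≤ g j a)
    (hG : ∀ j ∈ J, 0 < ∑ a ∈ A, g j a) (hw : ∀ j ∈ J, 0 ≤ w j) (hw1 : 1 ≤ ∑ j ∈ J, w j) :
    ∑ a ∈ A, ∏ j ∈ J, g j a ^ w j ≤ ∏ j ∈ J, (∑ a ∈ A, g j a) ^ w j := by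
  set W := ∑ j ∈ J, w j
  have hW : 0 < W := by linarith
  set G : κ → ℝ := fun j => ∑ a ∈ A, g j a
  have hy0 : ∀ j ∈ J, ∀ a ∈ A, 0 ≤ g j a / G j := fun j hj a ha =>
    div_nonneg (hg j hj a ha) (hG j hj).le
  have hy1 : ∀ j ∈ J, ∀ a ∈ A, g j a / G j ≤ 1 := fun j hj a ha =>
    (div_le_one (hG j hj)).2 (single_le_sum (hg j hj) ha)
  -- The normalised values are at most `1`, so lowering the exponents to `w j / W` only increases
  -- the product; these sum to `1`, as weighted AM-GM requires.
  have key : ∀ a ∈ A, ∏ j ∈ J, (g j a / G j) ^ w j ≤ ∑ j ∈ J, w j / W * (g j a / G j) := by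
    intro a ha
    refine le_trans ?_ (Real.geom_mean_le_arith_mean_weighted J (fun j => w j / W)
      (fun j => g j a / G j) (fun j hj => div_nonneg (hw j hj) hW.le)
      (by rw [← sum_div, div_self hW.ne']) (fun j hj => hy0 j hj a ha))
    refine prod_le_prod (fun j hj => Real.rpow_nonneg (hy0 j hj a ha) _) fun j hj => ?_
    rcases (hw j hj).eq_or_lt with h0 | h0
    · simp [← h0]
    · exact Real.rpow_le_rpow_of_exponent_ge_of_imp (hy0 j hj a ha) (hy1 j hj a ha)
        (div_le_self h0.le hw1) (fun _ h => absurd h h0.ne')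
  have hP : 0 ≤ ∏ j ∈ J, G j ^ w j := prod_nonneg fun j hj => Real.rpow_nonneg (hG j hj).le _
  calc ∑ a ∈ A, ∏ j ∈ J, g j a ^ w j
      = (∏ j ∈ J, G j ^ w j) * ∑ a ∈ A, ∏ j ∈ J, (g j a / G j) ^ w j := by
        rw [mul_sum]
        refine sum_congr rfl fun a ha => ?_
        rw [← prod_mul_distrib]
        refine prod_congr rfl fun j hj => ?_
        rw [← Real.mul_rpow (hG j hj).le (hy0 j hj a ha), mul_div_cancel₀ _ (hG j hj).ne']
    _ ≤ (∏ j ∈ J, G j ^ w j) * ∑ a ∈ A, ∑ j ∈ J, w j / W * (g j a / G j) :=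
        mul_le_mul_of_nonneg_left (sum_le_sum key) hP
    _ = ∏ j ∈ J, G j ^ w j := by
        rw [sum_comm]
        have : ∑ j ∈ J, ∑ a ∈ A, w j / W * (g j a / G j) = 1 := by
          rw [← div_self hW.ne', sum_div]
          refine sum_congr rfl fun j hj => ?_
          rw [← mul_sum, ← sum_div, div_self (hG j hj).ne', mul_one]
        rw [this, mul_one]

/-- The AGM inequality, for sets of valuations that agree outside of `S`. -/
theorem card_le_prod_card_image_rpow_aux {q : ConjunctiveQuery} {α : Type*} [DecidableEq α]
    {w : Fin q.numAtoms → ℝ} (hw : q.IsFractionalEdgeCover w) (S : Finset (Fin q.numVars)) :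
    ∀ X : Finset (Fin q.numVars → α), (∀ x ∈ X, ∀ y ∈ X, ∀ i ∉ S, x i = y i) →
      (X.card : ℝ) ≤ ∏ j, ((X.image (fun x => x ∘ q.atom j)).card : ℝ) ^ w j := by
  induction S using Finset.induction_on with
  | empty =>
    intro X hX
    rcases X.eq_empty_or_nonempty with rfl | hne
    · simp only [card_empty, Nat.cast_zero]
      exact prod_nonneg fun j _ => Real.rpow_nonneg (Nat.cast_nonneg _) _
    · have h1 : X.card ≤ 1 := card_le_one.2 fun x hx y hy =>
        funext fun i => hX x hx y hy i (notMem_empty i)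
      refine le_trans (b := (1 : ℝ)) (by exact_mod_cast h1) ?_
      rw [← prod_const_one (s := univ) (ι := Fin q.numAtoms)]
      refine prod_le_prod (fun _ _ => zero_le_one) fun j _ => Real.one_le_rpow ?_ (hw.1 j)
      exact_mod_cast (hne.image _).card_pos
  | insert i S hi ih =>
    intro X hX
    rcases X.eq_empty_or_nonempty with rfl | hne
    · simp only [card_empty, Nat.cast_zero]
      exact prod_nonneg fun j _ => Real.rpow_nonneg (Nat.cast_nonneg _) _
    set A := X.image (fun x => x i)
    set Xa : α → Finset (Fin q.numVars → α) := fun a => X.filter (fun x => x i = a)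
    set P : (j : Fin q.numAtoms) → Finset (Fin q.numVars → α) → Finset (Fin (q.arity j) → α) :=
      fun j Y => Y.image (fun x => x ∘ q.atom j)
    have hcard : X.card = ∑ a ∈ A, (Xa a).card :=
      card_eq_sum_card_fiberwise fun x hx => mem_image_of_mem _ hx
    have hmono (j a) : (P j (Xa a)).card ≤ (P j X).card :=
      card_le_card (image_subset_image (filter_subset _ _))
    -- An atom containing `i` sees the slicing coordinate, so the projections of different slices
    -- are disjoint. For the other atoms monotonicity suffices.
    have hsum (j) (hj : i ∈ q.vars j) : ∑ a ∈ A, (P j (Xa a)).card = (P j X).card := by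
      obtain ⟨c, hc⟩ := (q.mem_vars).1 hj
      rw [← card_biUnion]
      · congr 1
        ext t
        simp only [mem_biUnion, P, Xa, A, mem_image, mem_filter]
        constructor
        · rintro ⟨a, _, x, ⟨hx, _⟩, rfl⟩
          exact ⟨x, hx, rfl⟩
        · rintro ⟨x, hx, rfl⟩
          exact ⟨x i, ⟨x, hx, rfl⟩, x, ⟨hx, rfl⟩, rfl⟩
      · intro a _ b _ hab
        rw [Function.onFun, disjoint_left]
        simp only [P, Xa, mem_image, mem_filter]
        rintro t ⟨x, ⟨_, hxa⟩, rfl⟩ ⟨y, ⟨_, hyb⟩, hxy⟩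
        apply hab
        have := congrFun hxy c
        simp only [Function.comp, hc] at this
        rw [← hxa, ← hyb, this]
    set J := univ.filter (fun j => i ∈ q.vars j)
    set J' := univ.filter (fun j => ¬ i ∈ q.vars j)
    have hsplit (f : Fin q.numAtoms → ℝ) : ∏ j, f j = (∏ j ∈ J', f j) * ∏ j ∈ J, f j := by
      rw [mul_comm]
      exact (prod_filter_mul_prod_filter_not _ _ _).symm
    calc (X.card : ℝ) = ∑ a ∈ A, ((Xa a).card : ℝ) := by rw [hcard]; push_cast; rfl
      _ ≤ ∑ a ∈ A, ∏ j, ((P j (Xa a)).card : ℝ) ^ w j := by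
          refine sum_le_sum fun a _ => ih (Xa a) fun x hx y hy i' hi' => ?_
          simp only [Xa, mem_filter] at hx hy
          by_cases h : i' = i
          · rw [h, hx.2, hy.2]
          · exact hX x hx.1 y hy.1 i' (by simp [h, hi'])
      _ ≤ ∑ a ∈ A, (∏ j ∈ J', ((P j X).card : ℝ) ^ w j) *
            ∏ j ∈ J, ((P j (Xa a)).card : ℝ) ^ w j := by
          refine sum_le_sum fun a _ => ?_
          rw [hsplit]
          refine mul_le_mul_of_nonneg_right ?_
            (prod_nonneg fun j _ => Real.rpow_nonneg (Nat.cast_nonneg _) _)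
          refine prod_le_prod (fun j _ => Real.rpow_nonneg (Nat.cast_nonneg _) _) fun j _ => ?_
          exact Real.rpow_le_rpow (Nat.cast_nonneg _) (by exact_mod_cast hmono j a) (hw.1 j)
      _ = (∏ j ∈ J', ((P j X).card : ℝ) ^ w j) *
            ∑ a ∈ A, ∏ j ∈ J, ((P j (Xa a)).card : ℝ) ^ w j := by rw [mul_sum]
      _ ≤ (∏ j ∈ J', ((P j X).card : ℝ) ^ w j) *
            ∏ j ∈ J, (∑ a ∈ A, ((P j (Xa a)).card : ℝ)) ^ w j := by
          refine mul_le_mul_of_nonneg_left ?_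
            (prod_nonneg fun j _ => Real.rpow_nonneg (Nat.cast_nonneg _) _)
          refine sum_prod_rpow_le_prod_sum_rpow A J (fun j a => ((P j (Xa a)).card : ℝ)) w
            (fun _ _ _ _ => Nat.cast_nonneg _) (fun j hj => ?_) (fun j _ => hw.1 j) (hw.2 i)
          have := hsum j (mem_filter.1 hj).2
          rw [← Nat.cast_sum, this]
          exact_mod_cast (hne.image _).card_pos
      _ = ∏ j, ((P j X).card : ℝ) ^ w j := by
          rw [hsplit]
          congr 1
          refine prod_congr rfl fun j hj => ?_
          rw [← hsum j (mem_filter.1 hj).2, Nat.cast_sum]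

/-- The AGM inequality. -/
theorem card_le_prod_card_image_rpow {q : ConjunctiveQuery} {α : Type*} [DecidableEq α]
    {w : Fin q.numAtoms → ℝ} (hw : q.IsFractionalEdgeCover w) (X : Finset (Fin q.numVars → α)) :
    (X.card : ℝ) ≤ ∏ j, ((X.image (fun x => x ∘ q.atom j)).card : ℝ) ^ w j :=
  card_le_prod_card_image_rpow_aux hw univ X fun _ _ _ _ i hi => absurd (mem_univ i) hi

theorem card_le_sum_card_image_rpow {q : ConjunctiveQuery} {α : Type*} [DecidableEq α]
    {w : Fin q.numAtoms → ℝ} (hw : q.IsFractionalEdgeCover w) (X : Finset (Fin q.numVars → α)) :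
    (X.card : ℝ) ≤ (∑ j, (X.image (fun x => x ∘ q.atom j)).card : ℕ) ^ ∑ j, w j := by
  rcases X.eq_empty_or_nonempty with rfl | hne
  · simp only [card_empty, Nat.cast_zero]
    positivity
  refine (card_le_prod_card_image_rpow hw X).trans ?_
  have hle (j) : (X.image (fun x => x ∘ q.atom j)).card ≤
      ∑ j, (X.image (fun x => x ∘ q.atom j)).card :=
    single_le_sum (f := fun j => (X.image (fun x => x ∘ q.atom j)).card)
      (fun _ _ => Nat.zero_le _) (mem_univ j)
  have hpos : 0 < ∑ j, (X.image (fun x => x ∘ q.atom j)).card :=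
    (hne.image _).card_pos.trans_le (hle ⟨0, q.numAtoms_pos⟩)
  rw [Real.rpow_sum_of_pos (by exact_mod_cast hpos)]
  refine prod_le_prod (fun j _ => Real.rpow_nonneg (Nat.cast_nonneg _) _) fun j _ => ?_
  exact Real.rpow_le_rpow (Nat.cast_nonneg _) (by exact_mod_cast hle j) (hw.1 j)

/-! ### Random selection of tuples and the output of one server -/

section Selection

variable {q : ConjunctiveQuery} {n m : ℕ}

/-- The instance in which slot `s` of the relation `j` is filled with one of the two tuples
`e j (s, false)` and `e j (s, true)`, as chosen by `b`. -/
def selected (e : (j : Fin q.numAtoms) → Fin m × Bool ↪ (Fin (q.arity j) → Fin n))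
    (b : Fin q.numAtoms × Fin m → Bool) : Instance q n :=
  fun j => univ.image fun s => e j (s, b (j, s))

variable (e : (j : Fin q.numAtoms) → Fin m × Bool ↪ (Fin (q.arity j) → Fin n))

theorem apply_mem_selected {b : Fin q.numAtoms × Fin m → Bool} {j : Fin q.numAtoms} {s : Fin m}
    {c : Bool} : e j (s, c) ∈ selected e b j ↔ b (j, s) = c := by
  simp [selected]

theorem card_selected (b : Fin q.numAtoms × Fin m → Bool) (j : Fin q.numAtoms) :
    (selected e b j).card = m := by
  rw [selected, card_image_of_injective, card_univ, Fintype.card_fin]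
  intro s s' h
  simpa using congrArg Prod.fst ((e j).injective h)

/-- Every tuple known to be in the input halves the number of possible inputs. -/
theorem card_mul_two_pow_le (S : Finset (Fin q.numAtoms × Fin m → Bool))
    (X : Finset (Fin q.numVars → Fin n)) (hX : ∀ b ∈ S, ∀ x ∈ X, x ∈ answers q (selected e b)) :
    S.card * 2 ^ (∑ j, (X.image (fun x => x ∘ q.atom j)).card) ≤ 2 ^ (q.numAtoms * m) := by
  rcases S.eq_empty_or_nonempty with rfl | ⟨b₀, hb₀⟩
  · simp
  set P : (j : Fin q.numAtoms) → Finset (Fin (q.arity j) → Fin n) :=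
    fun j => X.image (fun x => x ∘ q.atom j)
  have hP {b} (hb : b ∈ S) (j) : P j ⊆ selected e b j := by
    intro t ht
    obtain ⟨x, hx, rfl⟩ := mem_image.1 ht
    exact hX b hb x hx j
  -- On these slots every choice in `S` must agree with `b₀`; they correspond bijectively to the
  -- tuples used by `X`.
  set known : Fin q.numAtoms × Fin m → Prop := fun c => e c.1 (c.2, b₀ c) ∈ P c.1
  have hcard (j) : (P j).card = ∑ s, if known (j, s) then 1 else 0 := by
    rw [← card_filter]
    symm
    refine card_bij (fun s _ => e j (s, b₀ (j, s))) (fun s hs => (mem_filter.1 hs).2) ?_ ?_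
    · intro s _ s' _ h
      simpa using congrArg Prod.fst ((e j).injective h)
    · intro t ht
      obtain ⟨s, -, rfl⟩ := mem_image.1 (hP hb₀ j ht)
      exact ⟨s, mem_filter.2 ⟨mem_univ _, ht⟩, rfl⟩
  have hsub : S ⊆ Fintype.piFinset fun c => if known c then {b₀ c} else univ := by
    intro b hb
    rw [Fintype.mem_piFinset]
    intro c
    split_ifs with hc
    · exact mem_singleton.2 ((apply_mem_selected e).1 (hP hb c.1 hc))
    · exact mem_univ _
  calc S.card * 2 ^ (∑ j, (P j).card)
      ≤ (∏ c, if known c then 1 else 2) * 2 ^ (∑ j, (P j).card) := by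
        refine Nat.mul_le_mul_right _ ((card_le_card hsub).trans (le_of_eq ?_))
        rw [Fintype.card_piFinset]
        refine prod_congr rfl fun c _ => ?_
        split_ifs <;> simp
    _ = (∏ c, if known c then 1 else 2) * ∏ c, if known c then 2 else 1 := by
        congr 1
        simp_rw [hcard]
        rw [← Fintype.sum_prod_type', ← prod_pow_eq_pow_sum]
        refine prod_congr rfl fun c _ => ?_
        split_ifs <;> simp
    _ = 2 ^ (q.numAtoms * m) := by
        rw [← prod_mul_distrib, prod_congr rfl (g := fun _ => 2)]
        · simp
        · intro c _
          split_ifs <;> rfl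

open Classical in
/-- A valuation all of whose tuples are available is an answer for at least a fraction
`2 ^ (-ℓ)` of the choices. -/
theorem two_pow_le_card_filter_answers (x : Fin q.numVars → Fin n)
    (hx : ∀ j, x ∘ q.atom j ∈ Set.range (e j)) :
    2 ^ (q.numAtoms * m) ≤
      2 ^ q.numAtoms * (univ.filter fun b => x ∈ answers q (selected e b)).card := by
  choose s hs using hx
  have hsub : (Fintype.piFinset fun c : Fin q.numAtoms × Fin m =>
      if (s c.1).1 = c.2 then {(s c.1).2} else univ) ⊆
        univ.filter fun b => x ∈ answers q (selected e b) := by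
    intro b hb
    rw [Fintype.mem_piFinset] at hb
    refine mem_filter.2 ⟨mem_univ _, fun j => ?_⟩
    have := hb (j, (s j).1)
    rw [if_pos rfl, mem_singleton] at this
    rw [← hs j]
    exact (apply_mem_selected e).2 this
  refine le_trans (le_of_eq ?_) (Nat.mul_le_mul_left _ (card_le_card hsub))
  have hj (j) : 2 * ∏ t : Fin m, (if (s j).1 = t then {(s j).2} else univ : Finset Bool).card =
      2 ^ m := by
    have h2 : 2 = ∏ t : Fin m, if (s j).1 = t then 2 else 1 := by simp
    conv_lhs => enter [1]; rw [h2]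
    rw [← prod_mul_distrib, prod_congr rfl (g := fun _ => 2)]
    · simp
    · intro t _
      split_ifs <;> simp
  calc 2 ^ (q.numAtoms * m) = ∏ _j : Fin q.numAtoms, 2 ^ m := by
        rw [prod_const, card_univ, Fintype.card_fin, ← pow_mul, mul_comm]
    _ = 2 ^ q.numAtoms * ∏ j : Fin q.numAtoms, ∏ t : Fin m,
          (if (s j).1 = t then {(s j).2} else univ : Finset Bool).card := by
        rw [prod_congr rfl fun j _ => (hj j).symm, prod_mul_distrib]
        simp
    _ = _ := by rw [Fintype.card_piFinset, Fintype.prod_prod_type]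

theorem exists_embedding_range_superset {β : Type*} [Fintype β] [DecidableEq β] (T : Finset β)
    (hT : T.card ≤ 2 * m) (hβ : 2 * m ≤ Fintype.card β) :
    ∃ f : Fin m × Bool ↪ β, ∀ t ∈ T, t ∈ Set.range f := by
  obtain ⟨T', hTT', hT'⟩ := exists_superset_card_eq hT hβ
  have f : Fin m × Bool ≃ T' := Fintype.equivOfCardEq (by simp [hT', mul_comm])
  refine ⟨f.toEmbedding.trans (Function.Embedding.subtype _), fun t ht => ?_⟩
  exact ⟨f.symm ⟨t, hTT' ht⟩, by simp⟩

/-- One factor `√2 ^ K` of `2 ^ K` absorbs the AGM bound; the other is kept to pay for the `2 ^ B`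
possible histories. -/
theorem exists_rpow_le_mul_sqrt_two_pow (ρ : ℝ) :
    ∃ C : ℝ, 0 < C ∧ ∀ K : ℕ, (K : ℝ) ^ ρ ≤ C * √2 ^ K := by
  have h2 : (1 : ℝ) < √2 := by
    rw [Real.lt_sqrt] <;> norm_num
  have hO : (fun K : ℕ => (K : ℝ) ^ ρ) =O[Filter.atTop] fun K : ℕ => √2 ^ K := by
    have := (isLittleO_rpow_exp_pos_mul_atTop ρ (Real.log_pos h2)).isBigO.comp_tendsto
      tendsto_natCast_atTop_atTop
    refine this.congr_right fun K => ?_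
    simp only [Function.comp]
    rw [mul_comm, Real.exp_nat_mul, Real.exp_log (by linarith)]
  obtain ⟨C, hC, h⟩ := Asymptotics.bound_of_isBigO_nat_atTop hO
  refine ⟨C, hC, fun K => ?_⟩
  have hK : √2 ^ K ≠ 0 := by positivity
  have := h hK
  rwa [Real.norm_of_nonneg (by positivity), Real.norm_of_nonneg (by positivity)] at this

/-- The total number of answers, over all choices, of a server that knows at most `B` bits. -/
theorem sum_card_output_le {w : Fin q.numAtoms → ℝ} (hw : q.IsFractionalEdgeCover w) {C : ℝ}
    (hC : ∀ K : ℕ, (K : ℝ) ^ (∑ j, w j) ≤ C * √2 ^ K) (hC0 : 0 < C)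
    {β : Type*} [DecidableEq β] (H : Finset β) (B : ℕ) (hH : H.card ≤ 2 ^ B)
    (h : (Fin q.numAtoms × Fin m → Bool) → β) (hh : ∀ b, h b ∈ H)
    (out : β → Finset (Fin q.numVars → Fin n))
    (hout : ∀ b, ∀ x ∈ out (h b), x ∈ answers q (selected e b)) :
    ∑ b, ((out (h b)).card : ℝ) ≤
      2 ^ (q.numAtoms * m) * ((2 * B : ℝ) ^ (∑ j, w j) + C) := by
  set N := q.numAtoms * m
  set ρ := ∑ j, w j
  have hρ : 0 < ρ := hw.sum_pos
  set cls : β → Finset (Fin q.numAtoms × Fin m → Bool) := fun a => univ.filter fun b => h b = a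
  have hcls : ∑ a ∈ H, ((cls a).card : ℝ) = 2 ^ N := by
    rw [← Nat.cast_sum, ← card_eq_sum_card_fiberwise fun b _ => hh b]
    simp [N]
  have key : ∀ a ∈ H, ((cls a).card : ℝ) * (out a).card ≤
      (cls a).card * (2 * B : ℝ) ^ ρ + C * 2 ^ N / 2 ^ B := by
    intro a _
    set K := ∑ j, ((out a).image (fun x => x ∘ q.atom j)).card
    have h1 : ((out a).card : ℝ) ≤ (K : ℝ) ^ ρ := card_le_sum_card_image_rpow hw (out a)
    have h2 : ((cls a).card : ℝ) * 2 ^ K ≤ 2 ^ N := by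
      exact_mod_cast card_mul_two_pow_le e (cls a) (out a) fun b hb x hx =>
        hout b x (by rwa [(mem_filter.1 hb).2])
    rcases le_total K (2 * B) with hK | hK
    · have : (K : ℝ) ^ ρ ≤ (2 * B : ℝ) ^ ρ :=
        Real.rpow_le_rpow (Nat.cast_nonneg _) (by exact_mod_cast hK) hρ.le
      have h3 : 0 ≤ C * 2 ^ N / 2 ^ B := by positivity
      have := mul_le_mul_of_nonneg_left (h1.trans this) (Nat.cast_nonneg (α := ℝ) (cls a).card)
      linarith
    -- Here the output reveals far more than `B` bits: the histories of this kind are so rare that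
    -- even `2 ^ B` of them contribute only `C * 2 ^ N`.
    · have h3 : (0 : ℝ) ≤ (cls a).card * (2 * B : ℝ) ^ ρ := by positivity
      have hs : (√2 : ℝ) ^ K * √2 ^ K = 2 ^ K := by
        rw [← mul_pow, Real.mul_self_sqrt (by norm_num)]
      have hB : (2 : ℝ) ^ B ≤ √2 ^ K := by
        have : (2 : ℝ) ^ B = √2 ^ (2 * B) := by rw [pow_mul, Real.sq_sqrt (by norm_num)]
        rw [this]
        refine pow_le_pow_right₀ ?_ hK
        rw [Real.le_sqrt] <;> norm_num
      have h4 : ((cls a).card : ℝ) * (out a).card ≤ C * 2 ^ N / 2 ^ B := by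
        rw [le_div_iff₀ (by positivity)]
        calc ((cls a).card : ℝ) * (out a).card * 2 ^ B
            ≤ (cls a).card * (C * √2 ^ K) * √2 ^ K := by
              gcongr
              exact h1.trans (hC K)
          _ = C * ((cls a).card * 2 ^ K) := by rw [← hs]; ring
          _ ≤ C * 2 ^ N := by gcongr
      linarith
  calc ∑ b, ((out (h b)).card : ℝ)
      = ∑ a ∈ H, ((cls a).card : ℝ) * (out a).card := by
        rw [← sum_fiberwise_of_maps_to (fun b _ => hh b)]
        refine sum_congr rfl fun a _ => ?_
        rw [sum_congr rfl (g := fun _ => ((out a).card : ℝ))]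
        · simp [cls]
        · intro b hb
          rw [(mem_filter.1 hb).2]
    _ ≤ ∑ a ∈ H, ((cls a).card * (2 * B : ℝ) ^ ρ + C * 2 ^ N / 2 ^ B) := sum_le_sum key
    _ = 2 ^ N * (2 * B : ℝ) ^ ρ + H.card * (C * 2 ^ N / 2 ^ B) := by
        rw [sum_add_distrib, ← sum_mul, hcls, sum_const, nsmul_eq_mul]
    _ ≤ 2 ^ N * (2 * B : ℝ) ^ ρ + 2 ^ B * (C * 2 ^ N / 2 ^ B) := by
        gcongr
        exact_mod_cast hH
    _ = 2 ^ N * ((2 * B : ℝ) ^ ρ + C) := by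
        field_simp

end Selection

/-! ### Counting histories under a load bound -/

section History

/-- All bit strings of length at most `L`. -/
def shortStrings (L : ℕ) : Finset (List Bool) :=
  (range (L + 1)).biUnion fun k => univ.image fun f : Fin k → Bool => List.ofFn f

theorem mem_shortStrings {L : ℕ} {l : List Bool} (h : l.length ≤ L) : l ∈ shortStrings L :=
  mem_biUnion.2 ⟨l.length, mem_range.2 (Nat.lt_succ_of_le h),
    mem_image.2 ⟨l.get, mem_univ _, List.ofFn_get l⟩⟩

theorem card_shortStrings_le (L : ℕ) : (shortStrings L).card ≤ 2 ^ (L + 1) := by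
  refine card_biUnion_le.trans ?_
  calc ∑ k ∈ range (L + 1), (univ.image fun f : Fin k → Bool => List.ofFn f).card
      ≤ ∑ k ∈ range (L + 1), 2 ^ k := sum_le_sum fun k _ => card_image_le.trans (by simp)
    _ ≤ 2 ^ (L + 1) := (Nat.geomSum_lt le_rfl (by simp)).le

/-- All sequences of `t` bit strings of length at most `L`. -/
def shortHistories (L : ℕ) : ℕ → Finset (List (List Bool))
  | 0 => {[]}
  | t + 1 => (shortHistories L t ×ˢ shortStrings L).image fun a => a.1 ++ [a.2]

theorem card_shortHistories_le (L t : ℕ) : (shortHistories L t).card ≤ 2 ^ ((L + 1) * t) := by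
  induction t with
  | zero => simp [shortHistories]
  | succ t ih =>
    refine card_image_le.trans ?_
    rw [card_product, Nat.mul_succ, pow_add]
    exact Nat.mul_le_mul ih (card_shortStrings_le L)

variable {q : ConjunctiveQuery} {n p : ℕ} (A : Algorithm q n p) {r : ℕ} {I : Instance q n}

theorem Algorithm.length_received_le {t : ℕ} (ht : t < r) (v : Fin p) :
    (A.received I t v).length ≤ A.load r I :=
  (le_sup (f := fun v => (A.received I t v).length) (mem_univ v)).trans
    (le_sup (f := fun t => univ.sup fun v => (A.received I t v).length) (mem_range.2 ht))

theorem Algorithm.history_mem_shortHistories {L : ℕ} (hL : A.load r I ≤ L) (v : Fin p) {t : ℕ}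
    (ht : t ≤ r) : A.history I t v ∈ shortHistories L t := by
  induction t with
  | zero => simp [shortHistories, Algorithm.history]
  | succ t ih =>
    exact mem_image.2 ⟨(A.history I t v, A.received I t v), mem_product.2 ⟨ih (by omega),
      mem_shortStrings ((A.length_received_le (by omega) v).trans hL)⟩, rfl⟩

theorem Algorithm.history_eq_replicate (hL : A.load r I = 0) (v : Fin p) {t : ℕ}
    (ht : t ≤ r) : A.history I t v = List.replicate t [] := by
  induction t with
  | zero => rfl
  | succ t ih =>
    have h : A.received I t v = [] :=
      List.eq_nil_of_length_eq_zero (by have := A.length_received_le (I := I) ht v; omega)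
    rw [List.replicate_succ', ← ih (by omega), ← h]
    rfl

end History

/-! ### Grids from vertex packings -/

/-- The valuations in the grid `∏ i, [d i]`. -/
def grid {k : ℕ} (n : ℕ) (d : Fin k → ℕ) : Finset (Fin k → Fin n) :=
  Fintype.piFinset fun i => univ.filter fun a : Fin n => (a : ℕ) < d i

theorem card_filter_val_lt {n d : ℕ} (h : d ≤ n) :
    (univ.filter fun a : Fin n => (a : ℕ) < d).card = d := by
  rw [Fin.card_filter_val_lt, min_eq_right h]

theorem card_grid {k n : ℕ} {d : Fin k → ℕ} (h : ∀ i, d i ≤ n) :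
    (grid n d).card = ∏ i, d i := by
  rw [grid, Fintype.card_piFinset]
  exact prod_congr rfl fun i _ => card_filter_val_lt (h i)

theorem card_image_grid_le {q : ConjunctiveQuery} {n : ℕ} {d : Fin q.numVars → ℕ}
    (h : ∀ i, d i ≤ n) (j : Fin q.numAtoms) :
    ((grid n d).image fun x => x ∘ q.atom j).card ≤ ∏ i ∈ q.vars j, d i := by
  have hsub : (grid n d).image (fun x => x ∘ q.atom j) ⊆
      (Fintype.piFinset fun i : q.vars j => univ.filter fun a : Fin n => (a : ℕ) < d i).image
        fun y a => y ⟨q.atom j a, (q.mem_vars).2 ⟨a, rfl⟩⟩ := by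
    intro t ht
    obtain ⟨x, hx, rfl⟩ := mem_image.1 ht
    refine mem_image.2 ⟨fun i => x i, ?_, rfl⟩
    rw [Fintype.mem_piFinset]
    exact fun i => (Fintype.mem_piFinset.1 hx) i
  refine (card_le_card hsub).trans (card_image_le.trans ?_)
  simp_rw [Fintype.card_piFinset, card_filter_val_lt (h _)]
  exact (prod_coe_sort (q.vars j) d).le

theorem half_le_floor {x : ℝ} (hx : 1 ≤ x) : x / 2 ≤ (⌊x⌋₊ : ℝ) := by
  have h1 : (1 : ℝ) ≤ ⌊x⌋₊ := by exact_mod_cast (Nat.one_le_floor_iff x).2 hx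
  linarith [Nat.lt_floor_add_one x]

/-- Slots for the hard instances, in which the tuples of a grid with about `m ^ ρ*` points are
available. -/
theorem exists_slots (q : ConjunctiveQuery) {u : Fin q.numVars → ℝ}
    (hu : q.IsFractionalVertexPacking u) {m : ℕ} (hm : 1 ≤ m) :
    ∃ (e : (j : Fin q.numAtoms) → Fin m × Bool ↪ (Fin (q.arity j) → Fin (2 * m)))
      (X : Finset (Fin q.numVars → Fin (2 * m))),
      (∀ x ∈ X, ∀ j, x ∘ q.atom j ∈ Set.range (e j)) ∧
      (m : ℝ) ^ (∑ i, u i) ≤ 2 ^ q.numVars * X.card := by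
  have hm' : (1 : ℝ) ≤ m := by exact_mod_cast hm
  -- The packing constraint keeps every projection of size at most `m`. Since `m ^ u i ≥ 1`,
  -- rounding down loses at most a factor `2` per variable.
  set d : Fin q.numVars → ℕ := fun i => ⌊(m : ℝ) ^ u i⌋₊
  have hd (i) : (d i : ℝ) ≤ (m : ℝ) ^ u i := Nat.floor_le (by positivity)
  have hprod (j) : ∏ i ∈ q.vars j, d i ≤ m := by
    have : ((∏ i ∈ q.vars j, d i : ℕ) : ℝ) ≤ m := by
      push_cast
      refine (prod_le_prod (fun _ _ => Nat.cast_nonneg _) fun i _ => hd i).trans ?_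
      rw [← Real.rpow_sum_of_pos (by linarith)]
      exact (Real.rpow_le_rpow_of_exponent_le hm' (hu.2 j)).trans (by simp)
    exact_mod_cast this
  have hdn (i) : d i ≤ 2 * m := by
    obtain ⟨j, hj⟩ := q.exists_mem_vars i
    have hui : u i ≤ 1 := (single_le_sum (fun i _ => hu.1 i) hj).trans (hu.2 j)
    have : (d i : ℝ) ≤ m := (hd i).trans
      ((Real.rpow_le_rpow_of_exponent_le hm' hui).trans (by simp))
    have : d i ≤ m := by exact_mod_cast this
    omega
  have hex (j) := exists_embedding_range_superset (m := m)
    ((grid (2 * m) d).image fun x => x ∘ q.atom j)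
    ((card_image_grid_le hdn j).trans ((hprod j).trans (by omega)))
    -- Domain size `2 * m` and positive arity leave room for two distinct tuples in each slot.
    (by
      rw [Fintype.card_fun, Fintype.card_fin, Fintype.card_fin]
      exact Nat.le_self_pow (q.arity_pos j).ne' _)
  choose e he using hex
  refine ⟨e, grid (2 * m) d, fun x hx j => he j _ (mem_image_of_mem _ hx), ?_⟩
  rw [card_grid hdn, Real.rpow_sum_of_pos (by linarith)]
  calc ∏ i, (m : ℝ) ^ u i ≤ ∏ i, 2 * (d i : ℝ) := by
        refine prod_le_prod (fun _ _ => by positivity) fun i _ => ?_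
        have := half_le_floor (Real.one_le_rpow hm' (hu.1 i))
        simp only [d]
        linarith
    _ = 2 ^ q.numVars * ((∏ i, d i : ℕ) : ℝ) := by
        rw [prod_mul_distrib]
        simp

/-! ### Combining the servers -/

section LowerBound

variable {q : ConjunctiveQuery} {n m p r : ℕ}
  {e : (j : Fin q.numAtoms) → Fin m × Bool ↪ (Fin (q.arity j) → Fin n)}
  {A : Algorithm q n p}

theorem mem_answers_of_mem_output {I : Instance q n} (hA : A.ComputesOn r I) {v : Fin p}
    {x : Fin q.numVars → Fin n} (hx : x ∈ A.output v (A.history I r v)) : x ∈ answers q I := by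
  rw [← hA]
  exact Set.mem_iUnion.2 ⟨v, hx⟩

/-- With zero load all histories are empty strings, so the answer could not vary with the choice;
yet flipping the bits that make `x` an answer destroys it. This gives `L ≥ 1`, needed to absorb
additive constants. -/
theorem exists_load_pos (hA : ∀ b, A.ComputesOn r (selected e b)) {x : Fin q.numVars → Fin n}
    (hx : ∀ j, x ∘ q.atom j ∈ Set.range (e j)) : ∃ b, 0 < A.load r (selected e b) := by
  by_contra! h
  have hconst (b b') : answers q (selected e b) = answers q (selected e b') := by
    rw [← hA b, ← hA b']
    simp_rw [A.history_eq_replicate (Nat.le_zero.1 (h _)) _ le_rfl]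
  choose s hs using hx
  have h1 : x ∈ answers q (selected e fun c => (s c.1).2) := fun j => by
    rw [← hs j]
    exact (apply_mem_selected e).2 rfl
  rw [hconst _ fun c => !(s c.1).2] at h1
  have := h1 ⟨0, q.numAtoms_pos⟩
  rw [← hs, apply_mem_selected e] at this
  simp at this

open Classical in
theorem two_pow_mul_card_le_sum_card_output (hA : ∀ b, A.ComputesOn r (selected e b))
    (X : Finset (Fin q.numVars → Fin n)) (hX : ∀ x ∈ X, ∀ j, x ∘ q.atom j ∈ Set.range (e j)) :
    2 ^ (q.numAtoms * m) * X.card ≤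
      2 ^ q.numAtoms * ∑ v, ∑ b, (A.output v (A.history (selected e b) r v)).card := by
  calc 2 ^ (q.numAtoms * m) * X.card = ∑ x ∈ X, 2 ^ (q.numAtoms * m) := by
        simp [mul_comm]
    _ ≤ ∑ x ∈ X, 2 ^ q.numAtoms * (univ.filter fun b => x ∈ answers q (selected e b)).card :=
        sum_le_sum fun x hx => two_pow_le_card_filter_answers e x (hX x hx)
    _ = 2 ^ q.numAtoms * ∑ b, (X.filter fun x => x ∈ answers q (selected e b)).card := by
        rw [← mul_sum]
        congr 1
        simp_rw [card_filter]
        exact sum_comm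
    _ ≤ _ := by
        refine Nat.mul_le_mul_left _ ?_
        rw [sum_comm]
        refine sum_le_sum fun b _ => ?_
        refine le_trans (card_le_card fun x hx => ?_) card_biUnion_le
        have := (mem_filter.1 hx).2
        rw [← hA b] at this
        obtain ⟨v, hv⟩ := Set.mem_iUnion.1 this
        exact mem_biUnion.2 ⟨v, mem_univ _, hv⟩

/-- The lower bound for one family of hard instances. -/
theorem exists_le_load {w : Fin q.numAtoms → ℝ} (hw : q.IsFractionalEdgeCover w) {C : ℝ}
    (hC : ∀ K : ℕ, (K : ℝ) ^ (∑ j, w j) ≤ C * √2 ^ K) (hC0 : 0 < C) (hm : 1 ≤ m) (hp : 1 ≤ p)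
    (X : Finset (Fin q.numVars → Fin n)) (hX : ∀ x ∈ X, ∀ j, x ∘ q.atom j ∈ Set.range (e j))
    (hcard : (m : ℝ) ^ (∑ j, w j) ≤ 2 ^ q.numVars * X.card)
    (hA : ∀ b, A.ComputesOn r (selected e b)) :
    ∃ b, ((2 ^ (q.numVars + q.numAtoms) * ((4 * r : ℝ) ^ (∑ j, w j) + C)) ^ (1 / ∑ j, w j))⁻¹ *
      (m / (p : ℝ) ^ (1 / ∑ j, w j)) ≤ A.load r (selected e b) := by
  set ρ := ∑ j, w j
  have hρ : 0 < ρ := hw.sum_pos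
  have hmρ : 0 < (m : ℝ) ^ ρ := by positivity
  have hne : X.Nonempty := by
    rw [nonempty_iff_ne_empty]
    rintro rfl
    simp only [card_empty, Nat.cast_zero, mul_zero] at hcard
    linarith
  obtain ⟨b₀, -, hmax⟩ := exists_max_image univ (fun b => A.load r (selected e b)) univ_nonempty
  obtain ⟨b₁, hb₁⟩ := exists_load_pos hA (hX _ hne.choose_spec)
  set L := A.load r (selected e b₀)
  have hL : 1 ≤ L := hb₁.trans_le (hmax b₁ (mem_univ _))
  have hL' : (1 : ℝ) ≤ L := by exact_mod_cast hL
  set D : ℝ := 2 ^ (q.numVars + q.numAtoms) * ((4 * r : ℝ) ^ ρ + C)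
  have hD : 0 < D := by positivity
  have hp0 : (0 : ℝ) < p := by exact_mod_cast hp
  have hserver (v : Fin p) :
      ∑ b, ((A.output v (A.history (selected e b) r v)).card : ℝ) ≤
        2 ^ (q.numAtoms * m) * (((4 * r : ℝ) ^ ρ + C) * (L : ℝ) ^ ρ) := by
    refine (sum_card_output_le e hw hC hC0 (shortHistories L r) ((L + 1) * r)
      (card_shortHistories_le L r) (fun b => A.history (selected e b) r v)
      (fun b => A.history_mem_shortHistories (hmax b (mem_univ _)) v le_rfl) (A.output v)
      (fun b x hx => mem_answers_of_mem_output (hA b) hx)).trans ?_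
    gcongr
    -- `L + 1 ≤ 2 * L` turns `2 * B` into `4 * r * L`.
    have h1 : (2 * ((L + 1) * r : ℕ) : ℝ) ^ ρ ≤ (4 * r : ℝ) ^ ρ * (L : ℝ) ^ ρ := by
      rw [← Real.mul_rpow (by positivity) (by positivity)]
      refine Real.rpow_le_rpow (by positivity) ?_ hρ.le
      push_cast
      nlinarith [mul_nonneg (Nat.cast_nonneg (α := ℝ) r) (sub_nonneg.2 hL')]
    have h2 : C ≤ C * (L : ℝ) ^ ρ := le_mul_of_one_le_right hC0.le (Real.one_le_rpow hL' hρ.le)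
    linarith
  have hmain : (m : ℝ) ^ ρ ≤ p * D * (L : ℝ) ^ ρ := by
    have h1 : (2 : ℝ) ^ (q.numAtoms * m) * X.card ≤
        2 ^ q.numAtoms * ∑ v, ∑ b, ((A.output v (A.history (selected e b) r v)).card : ℝ) := by
      exact_mod_cast two_pow_mul_card_le_sum_card_output hA X hX
    have h2 : ∑ v, ∑ b, ((A.output v (A.history (selected e b) r v)).card : ℝ) ≤
        p * (2 ^ (q.numAtoms * m) * (((4 * r : ℝ) ^ ρ + C) * (L : ℝ) ^ ρ)) := by
      refine (sum_le_sum fun v _ => hserver v).trans (le_of_eq ?_)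
      simp
    have h3 : (X.card : ℝ) ≤ 2 ^ q.numAtoms * (p * (((4 * r : ℝ) ^ ρ + C) * (L : ℝ) ^ ρ)) := by
      have h4 := h1.trans (mul_le_mul_of_nonneg_left h2 (by positivity))
      refine le_of_mul_le_mul_left (h4.trans (le_of_eq ?_))
        (show (0 : ℝ) < 2 ^ (q.numAtoms * m) by positivity)
      ring
    refine hcard.trans ((mul_le_mul_of_nonneg_left h3 (by positivity)).trans (le_of_eq ?_))
    simp only [D]
    ring
  refine ⟨b₀, ?_⟩
  have hroot := Real.rpow_le_rpow hmρ.le hmain (one_div_pos.2 hρ).le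
  rw [Real.mul_rpow (by positivity) (by positivity), Real.mul_rpow hp0.le hD.le,
    ← Real.rpow_mul (by positivity), ← Real.rpow_mul (by positivity), mul_one_div_cancel hρ.ne',
    Real.rpow_one, Real.rpow_one] at hroot
  rw [inv_mul_le_iff₀ (by positivity), div_le_iff₀ (by positivity)]
  linarith

end LowerBound

end MPC

/-- For every full conjunctive query `q` there is a family `F m` (`m ≥ 1`) of sets of instances
over domains of size `O(m)`, all of whose relations have exactly `m` tuples, such that every MPC
algorithm that computes `q` on `F m` with `p` servers in `r = O(1)` rounds has load
`Ω(m / p ^ (1 / ρ*(q)))` bits; the constant depends only on `q` and `r`. -/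
theorem mainTheorem3 (q : MPC.ConjunctiveQuery) :
    ∃ (C : ℕ) (n : ℕ → ℕ) (F : (m : ℕ) → Set (MPC.Instance q (n m))),
      (∀ m : ℕ, 1 ≤ m → n m ≤ C * m ∧ ∀ I ∈ F m, ∀ j, (I j).card = m) ∧
      ∀ r : ℕ, ∃ c : ℝ, 0 < c ∧
        ∀ (m p : ℕ), 1 ≤ m → 1 ≤ p →
          ∀ A : MPC.Algorithm q (n m) p,
            (∀ I ∈ F m, A.ComputesOn r I) →
              ∃ I ∈ F m,
                c * ((m : ℝ) / (p : ℝ) ^ (1 / q.edgeCoverNumber)) ≤ (A.load r I : ℝ) := by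
  obtain ⟨w, u, hw, hu, hwρ, huρ⟩ := q.exists_optimal_cover_packing
  obtain ⟨C, hC0, hC⟩ := MPC.exists_rpow_le_mul_sqrt_two_pow (∑ j, w j)
  have hslots := fun (m : ℕ) (hm : 1 ≤ m) => MPC.exists_slots q hu hm
  choose e X hX hcard using hslots
  refine ⟨2, fun m => 2 * m, fun m => {I | ∃ (hm : 1 ≤ m) (b : _), I = MPC.selected (e m hm) b},
    fun m hm => ⟨le_rfl, ?_⟩, fun r =>
      ⟨((2 ^ (q.numVars + q.numAtoms) * ((4 * r : ℝ) ^ (∑ j, w j) + C)) ^ (1 / ∑ j, w j))⁻¹, ?_,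
        fun m p hm hp A hA => ?_⟩⟩
  · rintro _ ⟨hm, b, rfl⟩ j
    exact MPC.card_selected _ b j
  · positivity
  · obtain ⟨b, hb⟩ := MPC.exists_le_load hw hC hC0 hm hp (X m hm) (hX m hm)
      (by rw [hwρ, ← huρ]; exact hcard m hm) fun b => hA _ ⟨hm, b, rfl⟩
    rw [← hwρ]
    exact ⟨_, ⟨hm, b, rfl⟩, hb⟩
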